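/- Let $r\neq 1$ be an integer. Let $P(r)=(P_{n,k})_{n,k\ge 0}$ be the coefficient array of the restricted Chebyshev-Boubaker polynomials, i.e. the Riordan array $$P_{n,k}=[x^n]\,\frac{1+rx^2}{1+x^2}\left(\frac{x}{1+x^2}\right)^k ,$$ an infinite lower triangular matrix with ones on the diagonal; let $M(r)=P(r)^{-1}$ be its moment matrix and let $s_n(r)=\sum_{k=0}^n M(r)_{n,k}$ be the row sums of $M(r)$. Put $$H_n=H_n(r)=r^nU_n\!\left(\frac{1/r-1}{2}\right)\quad(n\ge 0),\qquad H_{-1}=1,$$ where $U_n$ is the Chebyshev polynomial of the second kind ($H_n(r)$ is a polynomial in $r$ with constant term $1$, so $H_n(0)=1$). Then $H_n\ne 0$ for all $n\ge 0$, and, with $$\alpha_n=\frac{r^{2n+1}}{H_nH_{n+1}},\qquad \beta_n=\frac{H_{n-1}H_{n+1}}{H_n^2}\qquad(n\ge 0),$$ the sequence $s_n(r)$ is the moment sequence of the family of orthogonal polynomials $Q_n(x)=Q_n(x;r)$ given by $Q_0=1$, $Q_1=x-1$ and $$Q_{n+2}(x)=(x-\alpha_n)\,Q_{n+1}(x)-\beta_n\,Q_n(x)\qquad(n\ge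 0).$$ That is, $\deg Q_n=n$ for all $n$, and the linear functional $L$ on $\mathbb{R}[x]$ with $L(x^n)=s_n(r)$ for all $n$ satisfies $L(Q_mQ_n)=0$ for $m\ne n$ and $L(Q_n^2)\neq 0$ for all $n$. -/

import Mathlib

open Polynomial

noncomputable section

namespace ChebyshevBoubaker

/-- The Riordan array `(g, f)`: its `(n, k)` entry is the coefficient of `x ^ n` in `g * f ^ k`. -/
def riordan (g f : PowerSeries ℝ) (n k : ℕ) : ℝ :=
  PowerSeries.coeff n (g * f ^ k)

/-- The coefficient array of the restricted Chebyshev-Boubaker polynomials `P_n(x; r)`: the Riordan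
array `((1 + r x²) / (1 + x²), x / (1 + x²))`. It is lower triangular with ones on the diagonal. -/
def coeffArray (r : ℤ) : ℕ → ℕ → ℝ :=
  riordan ((1 + PowerSeries.C (r : ℝ) * PowerSeries.X ^ 2) * (1 + PowerSeries.X ^ 2)⁻¹)
    (PowerSeries.X * (1 + PowerSeries.X ^ 2)⁻¹)

/-- The moment matrix `M(r)`, the inverse of the infinite lower triangular matrix `coeffArray r`.
Row `n` of the inverse is the last row of the inverse of the leading block of size `n + 1`,
continued by zeros. -/
def momentMatrix (r : ℤ) (n k : ℕ) : ℝ :=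
  if h : k < n + 1 then
    (Matrix.of fun i j : Fin (n + 1) => coeffArray r i j)⁻¹ (Fin.last n) ⟨k, h⟩
  else 0

/-- The row sums `s_n(r)` of the moment matrix. -/
def rowSum (r : ℤ) (n : ℕ) : ℝ :=
  ∑ k ∈ Finset.range (n + 1), momentMatrix r n k

/-- `H_n(r) = r ^ n U_n((1/r - 1)/2)`. This is a polynomial in `r` with constant term `1`, whose
value is taken at `r = 0`. -/
def H (r : ℤ) (n : ℕ) : ℝ :=
  if r = 0 then 1
  else (r : ℝ) ^ n * (Chebyshev.U ℝ n).eval ((1 / (r : ℝ) - 1) / 2)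

/-- `α_n = r ^ (2n+1) / (H_n H_{n+1})`. -/
def α (r : ℤ) (n : ℕ) : ℝ :=
  (r : ℝ) ^ (2 * n + 1) / (H r n * H r (n + 1))

/-- `β_n = H_{n-1} H_{n+1} / H_n ^ 2`, where `H_{-1} = 1` is the empty Hankel determinant. -/
def β (r : ℤ) : ℕ → ℝ
  | 0 => H r 1 / H r 0 ^ 2
  | n + 1 => H r n * H r (n + 2) / H r (n + 1) ^ 2

/-- The polynomials `Q_n(x; r)` given by the three-term recurrence with coefficients `α`, `β`. -/
def Q (r : ℤ) : ℕ → ℝ[X]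
  | 0 => 1
  | 1 => X - 1
  | n + 2 => (X - C (α r n)) * Q r (n + 1) - C (β r n) * Q r n

/-- `s` is the moment sequence of the family of orthogonal polynomials `p`: each `p n` has degree
`n`, and `p` is orthogonal for the (quasi-definite) linear functional `L` with `L (x ^ n) = s n`. -/
def IsMomentSequenceOf (s : ℕ → ℝ) (p : ℕ → ℝ[X]) : Prop :=
  (∀ n, (p n).degree = n) ∧
    ∃ L : ℝ[X] →ₗ[ℝ] ℝ, (∀ n, L (X ^ n) = s n) ∧
      (∀ m n, m ≠ n → L (p m * p n) = 0) ∧ ∀ n, L (p n ^ 2) ≠ 0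

end ChebyshevBoubaker

end

open Polynomial

noncomputable section

namespace ChebyshevBoubaker

/-! ### The numbers `H r n` -/

/-! The `Q r n` are monic, one in each degree, so a functional `L` is fixed by `L 1 = 1` and `L (Q r
(n + 1)) = 0`. As all `β r n` are nonzero, the recurrence makes `Q r` orthogonal for `L` (Favard).
Since the moment matrix inverts the coefficient array, `X ^ n` is the combination of the `P r k`
with coefficients from its row `n`; hence the moments of `L` are the row sums once `L (P r k) = 1`
for all `k`. This follows by induction from the expansion `Q_succ_eq` of `Q r (n + 1)` in the `P r
k`. -/

theorem H_zero (r : ℤ) : H r 0 = 1 := by simp [H]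

theorem H_one (r : ℤ) : H r 1 = 1 - r := by
  by_cases h : r = 0
  · simp [H, h]
  · have h' : (r : ℝ) ≠ 0 := by exact_mod_cast h
    simp [H, h]
    field_simp

theorem H_add_two (r : ℤ) (n : ℕ) :
    H r (n + 2) = (1 - r) * H r (n + 1) - (r : ℝ) ^ 2 * H r n := by
  by_cases h : r = 0
  · simp [H, h]
  · have h' : (r : ℝ) ≠ 0 := by exact_mod_cast h
    have hU := congrArg (eval ((1 / (r : ℝ) - 1) / 2)) (Chebyshev.U_add_two ℝ (n : ℤ))
    simp only [eval_sub, eval_mul, eval_X, eval_ofNat] at hU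
    simp only [H, h, if_false]
    push_cast
    rw [hU]
    field_simp
    ring

theorem exists_int_H_eq (r : ℤ) (n : ℕ) : ∃ z : ℤ, H r n = ((1 + r * z : ℤ) : ℝ) := by
  induction n using Nat.twoStepInduction with
  | zero => exact ⟨0, by simp [H_zero]⟩
  | one => exact ⟨-1, by rw [H_one]; push_cast; ring⟩
  | more n h₁ h₂ =>
    obtain ⟨a, ha⟩ := h₁
    obtain ⟨b, hb⟩ := h₂
    refine ⟨b - (1 + r * b) - r * (1 + r * a), ?_⟩
    rw [H_add_two, ha, hb]
    push_cast
    ring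

theorem H_neg_one (n : ℕ) : H (-1) n = n + 1 := by
  induction n using Nat.twoStepInduction with
  | zero => simp [H_zero]
  | one => rw [H_one]; push_cast; ring
  | more n h₁ h₂ => rw [H_add_two, h₁, h₂]; push_cast; ring

/-- As `H r n` is an integer congruent to 1 modulo `r`, a zero forces `r = ±1`; at `r = -1` the
value is `n + 1`. -/
theorem H_ne_zero {r : ℤ} (hr : r ≠ 1) (n : ℕ) : H r n ≠ 0 := by
  intro h
  obtain ⟨z, hz⟩ := exists_int_H_eq r n
  have h0 : 1 + r * z = 0 := by
    rw [h] at hz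
    exact_mod_cast hz.symm
  have hu : IsUnit r := IsUnit.of_mul_eq_one (-z) (by linarith)
  rcases Int.isUnit_iff.1 hu with h1 | h1
  · exact hr h1
  · subst h1
    rw [H_neg_one] at h
    have : (0 : ℝ) ≤ n := n.cast_nonneg
    linarith

/-- `H r (n - 1)`, with the value `0` at `n = 0` that continues the recurrence of `H r`. -/
def predH (r : ℤ) : ℕ → ℝ
  | 0 => 0
  | n + 1 => H r n

theorem predH_succ (r : ℤ) (n : ℕ) : predH r (n + 1) = H r n := rfl

theorem H_succ (r : ℤ) (n : ℕ) : H r (n + 1) = (1 - r) * H r n - (r : ℝ) ^ 2 * predH r n := by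
  cases n with
  | zero => simp [predH, H_zero, H_one]
  | succ n => exact H_add_two r n

/-- Cassini's identity: each step of the recurrence multiplies the left side by `r ^ 2`. -/
theorem H_sq_sub (r : ℤ) (n : ℕ) :
    H r n ^ 2 - predH r n * H r (n + 1) = (r : ℝ) ^ (2 * n) := by
  induction n with
  | zero => simp [predH, H_zero]
  | succ n ih =>
    have h := H_succ r n
    rw [mul_add, pow_add, ← ih, predH, H_add_two]
    linear_combination H r (n + 1) * h

/-! ### The restricted Chebyshev-Boubaker polynomials -/

/-- The restricted Chebyshev-Boubaker polynomials. -/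
def P (r : ℤ) : ℕ → ℝ[X]
  | 0 => 1
  | 1 => X
  | 2 => X * X - C (1 - (r : ℝ))
  | n + 3 => X * P r (n + 2) - P r (n + 1)

theorem coeffArray_self_and_lt (r : ℤ) (n : ℕ) :
    coeffArray r n n = 1 ∧ ∀ k, n < k → coeffArray r n k = 0 := by
  have key : ∀ k, coeffArray r n k = PowerSeries.coeff n
      ((1 + PowerSeries.C (r : ℝ) * PowerSeries.X ^ 2) * (1 + PowerSeries.X ^ 2)⁻¹ *
        ((1 + PowerSeries.X ^ 2)⁻¹) ^ k * PowerSeries.X ^ k) := by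
    intro k
    rw [coeffArray, riordan, mul_pow]
    congr 1
    ring
  constructor
  · rw [key, PowerSeries.coeff_mul_X_pow', if_pos le_rfl]
    simp
  · intro k hk
    rw [key, PowerSeries.coeff_mul_X_pow', if_neg (by omega)]

theorem one_add_X_sq_mul_inv :
    (1 + PowerSeries.X ^ 2 : PowerSeries ℝ) * (1 + PowerSeries.X ^ 2)⁻¹ = 1 :=
  PowerSeries.mul_inv_cancel _ (by simp)

theorem coeffArray_add_two_succ (r : ℤ) (n k : ℕ) :
    coeffArray r (n + 2) (k + 1) = coeffArray r (n + 1) k - coeffArray r n (k + 1) := by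
  simp only [coeffArray, riordan]
  set u : PowerSeries ℝ := (1 + PowerSeries.X ^ 2)⁻¹ with hu
  set g : PowerSeries ℝ := 1 + PowerSeries.C (r : ℝ) * PowerSeries.X ^ 2
  have h : g * u * (PowerSeries.X * u) ^ (k + 1) +
      g * u * (PowerSeries.X * u) ^ (k + 1) * PowerSeries.X ^ 2 =
      g * u * (PowerSeries.X * u) ^ k * PowerSeries.X := by
    have h1 := one_add_X_sq_mul_inv
    rw [← hu] at h1
    rw [pow_succ]
    linear_combination (g * u * (PowerSeries.X * u) ^ k * PowerSeries.X) * h1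
  have h2 := congrArg (PowerSeries.coeff (n + 2)) h
  rw [map_add, PowerSeries.coeff_mul_X_pow, PowerSeries.coeff_succ_mul_X] at h2
  linarith

/-- The extra `r` at `n = 0` is why `P r 2` departs from the three-term recurrence. -/
theorem coeffArray_add_two_zero (r : ℤ) (n : ℕ) :
    coeffArray r (n + 2) 0 = (if n = 0 then (r : ℝ) else 0) - coeffArray r n 0 := by
  simp only [coeffArray, riordan, pow_zero, mul_one]
  set u : PowerSeries ℝ := (1 + PowerSeries.X ^ 2)⁻¹ with hu
  set g : PowerSeries ℝ := 1 + PowerSeries.C (r : ℝ) * PowerSeries.X ^ 2 with hg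
  have h : g * u + g * u * PowerSeries.X ^ 2 = g := by
    have h1 := one_add_X_sq_mul_inv
    rw [← hu] at h1
    linear_combination g * h1
  have h2 := congrArg (PowerSeries.coeff (n + 2)) h
  rw [map_add, PowerSeries.coeff_mul_X_pow] at h2
  have h3 : PowerSeries.coeff (n + 2) g = if n = 0 then (r : ℝ) else 0 := by
    rw [hg, map_add, PowerSeries.coeff_mul_X_pow, PowerSeries.coeff_one, PowerSeries.coeff_C]
    simp
  linarith

theorem coeffArray_zero_zero (r : ℤ) : coeffArray r 0 0 = 1 := (coeffArray_self_and_lt r 0).1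

theorem coeffArray_one_zero (r : ℤ) : coeffArray r 1 0 = 0 := by
  simp only [coeffArray, riordan, pow_zero, mul_one]
  set u : PowerSeries ℝ := (1 + PowerSeries.X ^ 2)⁻¹ with hu
  set g : PowerSeries ℝ := 1 + PowerSeries.C (r : ℝ) * PowerSeries.X ^ 2 with hg
  have h : g * u = 1 + PowerSeries.X * (PowerSeries.X * (PowerSeries.C (r : ℝ) * u - u)) := by
    have h1 := one_add_X_sq_mul_inv
    rw [← hu] at h1
    rw [hg]
    linear_combination h1
  rw [h, map_add, PowerSeries.coeff_succ_X_mul]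
  simp [PowerSeries.coeff_one]

theorem coeff_P (r : ℤ) (n : ℕ) : ∀ k, (P r n).coeff k = coeffArray r n k := by
  induction n using Nat.strong_induction_on with
  | _ n ih =>
    intro k
    match n, ih with
    | 0, _ =>
      rcases k with _ | k
      · simp [P, coeffArray_zero_zero]
      · simp [P, coeff_one, (coeffArray_self_and_lt r 0).2 (k + 1) (by omega)]
    | 1, _ =>
      rcases k with _ | _ | k
      · simp [P, coeffArray_one_zero]
      · simp [P, (coeffArray_self_and_lt r 1).1]
      · simp [P, coeff_X, (coeffArray_self_and_lt r 1).2 (k + 1 + 1) (by omega)]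
    | 2, ih =>
      rcases k with _ | k
      · simp [P, coeffArray_add_two_zero r 0, coeffArray_zero_zero]
      · rw [coeffArray_add_two_succ r 0, zero_add, ← ih 1 (by omega),
          (coeffArray_self_and_lt r 0).2 (k + 1) (by omega)]
        rw [P, P, coeff_sub, coeff_X_mul, coeff_C_succ]
    | n + 3, ih =>
      rcases k with _ | k
      · rw [coeffArray_add_two_zero r (n + 1), ← ih (n + 1) (by omega)]
        simp [P]
      · rw [coeffArray_add_two_succ r (n + 1), ← ih (n + 1) (by omega), ← ih (n + 2) (by omega)]
        simp [P, coeff_X_mul]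

theorem sum_momentMatrix_mul_P (r : ℤ) (n : ℕ) :
    ∑ k ∈ Finset.range (n + 1), C (momentMatrix r n k) * P r k = X ^ n := by
  set A : Matrix (Fin (n + 1)) (Fin (n + 1)) ℝ := Matrix.of fun i j => coeffArray r i j with hA
  have hdet : A.det = 1 := by
    rw [Matrix.det_of_isLowerTriangular]
    · exact Finset.prod_eq_one fun i _ => (coeffArray_self_and_lt r i).1
    · intro i j hij
      exact (coeffArray_self_and_lt r i).2 j hij
  have hinv : A⁻¹ * A = 1 := Matrix.nonsing_inv_mul A (by simp [hdet])
  ext j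
  simp only [finsetSum_coeff, coeff_C_mul, coeff_P, coeff_X_pow]
  by_cases hj : j < n + 1
  · have h := congrFun (congrFun hinv (Fin.last n)) ⟨j, hj⟩
    rw [Matrix.mul_apply, Matrix.one_apply] at h
    rw [Finset.sum_range]
    simp only [Fin.ext_iff, Fin.val_last] at h
    simp only [eq_comm (a := j)]
    rw [← h]
    refine Finset.sum_congr rfl fun i _ => ?_
    rw [momentMatrix, dif_pos i.isLt]
    rfl
  · rw [if_neg (by omega)]
    refine Finset.sum_eq_zero fun i hi => ?_
    rw [(coeffArray_self_and_lt r i).2 j (by have := Finset.mem_range.1 hi; omega), mul_zero]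

/-! ### Expansion of `Q r n` in the polynomials `P r k` -/

/-- The weights in the expansion of `Q r n` in the polynomials `P r k`. -/
def weight (r : ℤ) (n : ℕ) : ℝ := H r n + r * predH r n

/-- The weighted partial sums `∑ k < n, (-r) ^ (n - 1 - k) * weight r k * P r k`. -/
def T (r : ℤ) : ℕ → ℝ[X]
  | 0 => 0
  | n + 1 => C (weight r n) * P r n - C (r : ℝ) * T r n

theorem weight_zero (r : ℤ) : weight r 0 = 1 := by simp [weight, predH, H_zero]

theorem weight_one (r : ℤ) : weight r 1 = 1 := by simp [weight, predH, H_zero, H_one]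

theorem weight_add_two (r : ℤ) (n : ℕ) :
    weight r (n + 2) = (1 - r) * weight r (n + 1) - (r : ℝ) ^ 2 * weight r n := by
  simp only [weight, predH_succ, H_add_two]
  linear_combination (r : ℝ) * H_succ r n

/-- The weights satisfy the recurrence of `H r`, so the product telescopes to three terms. -/
theorem X_mul_T_add_two (r : ℤ) (n : ℕ) :
    X * T r (n + 2) = C (1 - (r : ℝ)) * T r (n + 1) + C (weight r (n + 1)) * P r (n + 2)
      - C (r * weight r n) * P r (n + 1) := by
  induction n with
  | zero =>
    simp only [T, P, weight_zero, weight_one, map_one, map_sub, map_mul, zero_add]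
    ring
  | succ n ih =>
    have hw := congrArg C (weight_add_two r n)
    simp only [map_sub, map_mul, map_pow, map_one] at hw ih ⊢
    have hT : T r (n + 2) = C (weight r (n + 1)) * P r (n + 1) - C (r : ℝ) * T r (n + 1) := rfl
    rw [show T r (n + 1 + 2) = C (weight r (n + 2)) * P r (n + 2) - C (r : ℝ) * T r (n + 2)
      from rfl, show T r (n + 1 + 1) = C (weight r (n + 1)) * P r (n + 1) - C (r : ℝ) * T r (n + 1)
      from rfl, show P r (n + 1 + 2) = X * P r (n + 2) - P r (n + 1) from rfl]
    linear_combination (-C (r : ℝ)) * ih + P r (n + 1) * hw + X * C (r : ℝ) * hT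

theorem Q_succ_eq {r : ℤ} (hr : r ≠ 1) (n : ℕ) :
    Q r (n + 1) = P r (n + 1) - C (H r n)⁻¹ * T r (n + 1) := by
  induction n using Nat.twoStepInduction with
  | zero => simp [Q, P, T, H_zero, weight_zero]
  | one =>
    have h1 := H_ne_zero hr 1
    rw [H_one] at h1
    have hα : α r 0 = (1 - (r : ℝ))⁻¹ - 1 := by
      rw [α, H_zero, H_one]
      field_simp
      ring
    simp only [Q, P, T, β, hα, H_zero, H_one, weight_zero, weight_one]
    have hc : C (1 - (r : ℝ))⁻¹ * (1 - C (r : ℝ)) = 1 := by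
      rw [← C_1, ← C_sub, ← C_mul, inv_mul_cancel₀ h1]
    simp only [map_sub, map_one, one_pow, div_one]
    linear_combination hc
  | more n h₁ h₂ =>
    have hb := H_ne_zero hr n
    have hc := H_ne_zero hr (n + 1)
    have hd := H_ne_zero hr (n + 2)
    have hC := H_sq_sub r (n + 1)
    have hC' := H_sq_sub r n
    have hd' := H_add_two r n
    -- Cassini replaces the power of `r` by values of `H r`, leaving rational identities in those
    -- values.
    have hα : α r (n + 1) = r * (H r (n + 1) ^ 2 - H r n * H r (n + 2)) /
        (H r (n + 1) * H r (n + 2)) := by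
      rw [α, show H r n = predH r (n + 1) from rfl, hC]
      ring
    have hcas : H r (n + 1) ^ 2 - H r n * H r (n + 2) =
        (r : ℝ) ^ 2 * (H r n ^ 2 - predH r n * H r (n + 1)) := by
      rw [hC', show H r n = predH r (n + 1) from rfl, hC]
      ring
    have hβ : β r (n + 1) = H r n * H r (n + 2) / H r (n + 1) ^ 2 := rfl
    -- `e₁`, `e₂`, `e₃` compare the coefficients of `P r (n + 2)`, `P r (n + 1)` and `T r (n + 1)`
    -- on the two sides.
    have e₁ : weight r (n + 1) * (H r (n + 1))⁻¹ + α r (n + 1) =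
        weight r (n + 2) * (H r (n + 2))⁻¹ := by
      rw [hα]
      simp only [weight, predH_succ]
      field_simp
      ring
    have e₂ : 1 + r * weight r n * (H r (n + 1))⁻¹
        + α r (n + 1) * (H r (n + 1))⁻¹ * weight r (n + 1) - β r (n + 1) =
        r * weight r (n + 1) * (H r (n + 2))⁻¹ := by
      rw [hα, hβ]
      simp only [weight, predH_succ]
      field_simp
      linear_combination H r (n + 2) * hcas
    have e₃ : β r (n + 1) * (H r n)⁻¹ - (1 - r) * (H r (n + 1))⁻¹
        - α r (n + 1) * r * (H r (n + 1))⁻¹ = -((r : ℝ) ^ 2 * (H r (n + 2))⁻¹) := by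
      rw [hα, hβ]
      field_simp
      linear_combination H r (n + 2) * hd'
    have hT := X_mul_T_add_two r n
    replace e₁ := congrArg C e₁
    replace e₂ := congrArg C e₂
    replace e₃ := congrArg C e₃
    simp only [map_sub, map_add, map_mul, map_pow, map_one, map_neg] at e₁ e₂ e₃ hT
    have hT2 : T r (n + 2) = C (weight r (n + 1)) * P r (n + 1) - C (r : ℝ) * T r (n + 1) := rfl
    rw [show Q r (n + 2 + 1) = (X - C (α r (n + 1))) * Q r (n + 1 + 1)
      - C (β r (n + 1)) * Q r (n + 1) from rfl, h₁, h₂,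
      show T r (n + 2 + 1) = C (weight r (n + 2)) * P r (n + 2) - C (r : ℝ) * T r (n + 2) from rfl,
      show P r (n + 2 + 1) = X * P r (n + 2) - P r (n + 1) from rfl]
    linear_combination (-C (H r (n + 1))⁻¹) * hT - P r (n + 2) * e₁ + P r (n + 1) * e₂
      + T r (n + 1) * e₃
      + (C (α r (n + 1)) * C (H r (n + 1))⁻¹ - C (r : ℝ) * C (H r (n + 2))⁻¹) * hT2

/-! ### Orthogonality -/

theorem Q_monic_natDegree (r : ℤ) (n : ℕ) : (Q r n).Monic ∧ (Q r n).natDegree = n := by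
  induction n using Nat.twoStepInduction with
  | zero => simp [Q]
  | one =>
    exact ⟨by simpa [Q] using monic_X_sub_C (1 : ℝ), by simpa [Q] using natDegree_X_sub_C (1 : ℝ)⟩
  | more n h₁ h₂ =>
    have hm : ((X - C (α r n)) * Q r (n + 1)).Monic := (monic_X_sub_C _).mul h₂.1
    have hd : ((X - C (α r n)) * Q r (n + 1)).natDegree = n + 2 := by
      rw [(monic_X_sub_C _).natDegree_mul h₂.1, natDegree_X_sub_C, h₂.2]
      ring
    have hlt : (C (β r n) * Q r n).degree < ((X - C (α r n)) * Q r (n + 1)).degree := by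
      rw [← smul_eq_C_mul]
      refine (degree_smul_le _ _).trans_lt ?_
      rw [degree_eq_natDegree h₁.1.ne_zero, degree_eq_natDegree hm.ne_zero, hd, h₁.2]
      exact_mod_cast (by omega : n < n + 2)
    refine ⟨hm.sub_of_left hlt, ?_⟩
    rw [Q, natDegree_eq_of_degree_eq (degree_sub_eq_left_of_degree_lt hlt), hd]

theorem Q_degree (r : ℤ) (n : ℕ) : (Q r n).degree = n := by
  rw [degree_eq_natDegree (Q_monic_natDegree r n).1.ne_zero, (Q_monic_natDegree r n).2]

/-- The sequence `Q r` as a polynomial sequence with one member of each degree. -/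
def QSequence (r : ℤ) : Polynomial.Sequence ℝ where
  elems' := Q r
  degree_eq' := Q_degree r

theorem exists_functional (r : ℤ) :
    ∃ L : ℝ[X] →ₗ[ℝ] ℝ, L 1 = 1 ∧ ∀ n, L (Q r (n + 1)) = 0 := by
  have hu : ∀ i, IsUnit ((QSequence r) i).leadingCoeff := fun i => by
    rw [show (QSequence r) i = Q r i from rfl, (Q_monic_natDegree r i).1.leadingCoeff]
    exact isUnit_one
  let b := (QSequence r).basis hu
  have hb : ∀ n, b n = Q r n := fun n => by simp [b]; rfl
  -- `L` is the coordinate along `Q r 0 = 1`.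
  refine ⟨b.constr ℝ fun n => if n = 0 then 1 else 0, ?_, fun n => ?_⟩
  · rw [show (1 : ℝ[X]) = b 0 by rw [hb]; rfl, Module.Basis.constr_basis, if_pos rfl]
  · rw [← hb, Module.Basis.constr_basis, if_neg (by omega)]

variable {r : ℤ} {L : ℝ[X] →ₗ[ℝ] ℝ}

theorem map_C_mul (L : ℝ[X] →ₗ[ℝ] ℝ) (a : ℝ) (p : ℝ[X]) : L (C a * p) = a * L p := by
  rw [← smul_eq_C_mul, map_smul, smul_eq_mul]

/-- The weights are chosen so that `L (T r (n + 1)) = weight r n - r * predH r n = H r n`; then `L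
(Q r (n + 1)) = 0` forces `L (P r (n + 1)) = 1`. -/
theorem map_P_eq_one (hr : r ≠ 1) (h1 : L 1 = 1) (hQ : ∀ n, L (Q r (n + 1)) = 0) (n : ℕ) :
    L (P r n) = 1 ∧ L (T r n) = predH r n := by
  induction n with
  | zero => simp [P, T, predH, h1]
  | succ n ih =>
    have hT : L (T r (n + 1)) = H r n := by
      rw [T, map_sub, map_C_mul, map_C_mul, ih.1, ih.2, weight]
      ring
    refine ⟨?_, hT⟩
    have h := hQ n
    rw [Q_succ_eq hr, map_sub, map_C_mul, hT, inv_mul_cancel₀ (H_ne_zero hr n)] at h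
    linarith

theorem map_X_pow (hr : r ≠ 1) (h1 : L 1 = 1) (hQ : ∀ n, L (Q r (n + 1)) = 0) (n : ℕ) :
    L (X ^ n) = rowSum r n := by
  rw [← sum_momentMatrix_mul_P r n, map_sum, rowSum]
  refine Finset.sum_congr rfl fun k _ => ?_
  rw [map_C_mul, (map_P_eq_one hr h1 hQ k).1, mul_one]

theorem X_mul_Q_succ (r : ℤ) (n : ℕ) :
    X * Q r (n + 1) = Q r (n + 2) + C (α r n) * Q r (n + 1) + C (β r n) * Q r n := by
  rw [Q]
  ring

theorem map_X_pow_succ_mul (L : ℝ[X] →ₗ[ℝ] ℝ) (r : ℤ) (k n : ℕ) :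
    L (X ^ (k + 1) * Q r (n + 1)) = L (X ^ k * Q r (n + 2)) + α r n * L (X ^ k * Q r (n + 1))
      + β r n * L (X ^ k * Q r n) := by
  rw [pow_succ, mul_assoc, X_mul_Q_succ, ← map_C_mul, ← map_C_mul, ← map_add, ← map_add]
  congr 1
  ring

/-- Each factor `X` lowers the index by at most one, so `Q r 0` is never reached. -/
theorem map_X_pow_mul_Q_of_lt (hQ : ∀ n, L (Q r (n + 1)) = 0) (k : ℕ) :
    ∀ n, k < n → L (X ^ k * Q r n) = 0 := by
  induction k with
  | zero =>
    rintro (_ | n) h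
    · omega
    · simpa using hQ n
  | succ k ih =>
    rintro (_ | n) h
    · omega
    · rw [map_X_pow_succ_mul, ih _ (by omega), ih _ (by omega), ih _ (by omega)]
      ring

theorem β_ne_zero (hr : r ≠ 1) (n : ℕ) : β r n ≠ 0 := by
  cases n with
  | zero => exact div_ne_zero (H_ne_zero hr _) (pow_ne_zero _ (H_ne_zero hr _))
  | succ n =>
    exact div_ne_zero (mul_ne_zero (H_ne_zero hr _) (H_ne_zero hr _))
      (pow_ne_zero _ (H_ne_zero hr _))

/-- Only the `β` term survives, so the value is the product of `β r i` over `i < n`. -/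
theorem map_X_pow_mul_Q_self_ne_zero (hr : r ≠ 1) (h1 : L 1 = 1)
    (hQ : ∀ n, L (Q r (n + 1)) = 0) (n : ℕ) : L (X ^ n * Q r n) ≠ 0 := by
  induction n with
  | zero => simp [Q, h1]
  | succ n ih =>
    rw [map_X_pow_succ_mul, map_X_pow_mul_Q_of_lt hQ n _ (by omega),
      map_X_pow_mul_Q_of_lt hQ n _ (by omega), mul_zero, zero_add, zero_add]
    exact mul_ne_zero (β_ne_zero hr n) ih

theorem map_mul_Q_of_degree_lt (hQ : ∀ n, L (Q r (n + 1)) = 0) {n : ℕ} {p : ℝ[X]}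
    (hp : p.degree < n) : L (p * Q r n) = 0 := by
  by_cases h0 : p = 0
  · simp [h0]
  rw [p.as_sum_range' n ((natDegree_lt_iff_degree_lt h0).2 hp), Finset.sum_mul, map_sum]
  refine Finset.sum_eq_zero fun k hk => ?_
  rw [← C_mul_X_pow_eq_monomial, mul_assoc, map_C_mul,
    map_X_pow_mul_Q_of_lt hQ k n (Finset.mem_range.1 hk), mul_zero]

theorem map_Q_sq (hQ : ∀ n, L (Q r (n + 1)) = 0) (n : ℕ) :
    L (Q r n ^ 2) = L (X ^ n * Q r n) := by
  have hlt : (Q r n - X ^ n).degree < (n : WithBot ℕ) := by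
    rw [← Q_degree r n]
    refine degree_sub_lt_left (by rw [Q_degree, degree_X_pow]) (Q_monic_natDegree r n).1.ne_zero ?_
    rw [(Q_monic_natDegree r n).1.leadingCoeff, (monic_X_pow n).leadingCoeff]
  have h := map_mul_Q_of_degree_lt hQ hlt
  rw [sub_mul, map_sub, sub_eq_zero] at h
  rw [sq, h]

theorem map_Q_mul_Q (hQ : ∀ n, L (Q r (n + 1)) = 0) {m n : ℕ} (hmn : m ≠ n) :
    L (Q r m * Q r n) = 0 := by
  rcases hmn.lt_or_gt with h | h
  · exact map_mul_Q_of_degree_lt hQ (by rw [Q_degree]; exact_mod_cast h)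
  · rw [mul_comm]
    exact map_mul_Q_of_degree_lt hQ (by rw [Q_degree]; exact_mod_cast h)

end ChebyshevBoubaker

end

theorem mainTheorem3 (r : ℤ) (hr : r ≠ 1) :
    (∀ n, ChebyshevBoubaker.H r n ≠ 0) ∧
      ChebyshevBoubaker.IsMomentSequenceOf
        (ChebyshevBoubaker.rowSum r) (ChebyshevBoubaker.Q r) := by
  obtain ⟨L, h1, hQ⟩ := ChebyshevBoubaker.exists_functional r
  refine ⟨ChebyshevBoubaker.H_ne_zero hr, ChebyshevBoubaker.Q_degree r, L,
    ChebyshevBoubaker.map_X_pow hr h1 hQ, fun m n => ChebyshevBoubaker.map_Q_mul_Q hQ, fun n => ?_⟩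
  rw [ChebyshevBoubaker.map_Q_sq hQ]
  exact ChebyshevBoubaker.map_X_pow_mul_Q_self_ne_zero hr h1 hQ n
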